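/- **Setting.** A *pCFG* $\mathcal C$ consists of a finite set $L$ of locations, a finite set $\mathcal V$ of real-valued program variables, output variables $\mathcal V_{out}\subseteq\mathcal V$, an initial location $\ell_{in}$, a terminal location $\ell_{out}$, a set $\theta_{in}\subseteq\mathbb R^{\mathcal V}$ of inputs, and a finite set of transitions $\tau=(\ell,\mathrm{Pr})$ with $\ell\in L$ and $\mathrm{Pr}$ a probability distribution on $L$. Each transition has a Borel guard $G(\tau)\subseteq\mathbb R^{\mathcal V}$ and an update, which either changes nothing, or assigns to a variable $x_j$ the value of a Borel function $u:\mathbb R^{\mathcal V}\to\mathbb R$, or samples $x_j$ from a probability distribution on $\mathbb R$. In every location the guards of the outgoing transitions are pairwise disjoint and cover $\mathbb R^{\mathcal V}$; the only transition leaving $\ell_{out}$ is a self-loop with guard true and no update. In a state $(\ell,\mathbf x)\in L\times\mathbb R^{\mathcal V}$ the unique enabled transition $\tau=(\ell,\mathrm{Pr})$ (that is, $\mathbf x\in G(\tau)$) chooses the next location $\ell'$ from $\mathrm{Pr}$ and, independently, the next valuation $\mathbf x'$ by its update. This defines a Markov chain on states; $\mathbb P_{\mathbf x}$ denotes the law of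 its trajectory started in $(\ell_{in},\mathbf x)$, for $\mathbf x\in\theta_{in}$. A *run* is an infinite sequence of states which starts in some $(\ell_{in},\mathbf x)$ with $\mathbf x\in\theta_{in}$ and in which each state is a successor of the previous one, i.e. has a location with $\mathrm{Pr}(\ell')>0$ and a valuation that the update can produce (sampled values ranging over the support of the distribution). A state is *reachable* if it occurs in a finite path of this kind. Let $\mathit{TimeTerm}\in\mathbb N\cup\{\infty\}$ be the first time at which $\ell_{out}$ is visited; $\mathcal C$ is *almost-surely terminating* if $\mathbb P_{\mathbf x}[\mathit{TimeTerm}<\infty]=1$ for all $\mathbf x\in\theta_{in}$. Write $\mathbf x^{out}$ for the projection of $\mathbf x$ to $\mathbb R^{\mathcal V_{out}}$, and $\mathit{Output}(A)$ for the event that a state $(\ell_{out},\mathbf x)$ with $\mathbf x^{out}\in A$ is reached. For a relation $\Phi$ on $\mathbb R^{\mathcal V}$ (similarity) and $\varepsilon\ge 0$, an almost-surely terminating $\mathcal C$ is *$\varepsilon$-DP* if $\mathbb P_{\mathbf x_1}[\mathit{Output}(A)]\le e^{\varepsilon}\,\mathbb P_{\mathbf x_2}[\mathit{Output}(A)]$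 for all $\mathbf x_1,\mathbf x_2\in\theta_{in}$ with $\Phi(\mathbf x_1,\mathbf x_2)$ and all Borel $A\subseteq\mathbb R^{\mathcal V_{out}}$. An *invariant* $I$ assigns to each location $\ell$ a set $I(\ell)\subseteq\mathbb R^{\mathcal V}$ such that $\mathbf x\in I(\ell)$ for every reachable state $(\ell,\mathbf x)$. A *state function* is a map $\eta:L\times\mathbb R^{\mathcal V}\to\mathbb R$ that is Borel in the valuation. **Super/submartingales.** Let $f:\mathbb R^{\mathcal V_{out}}\to\mathbb R$ be Borel. A *UESM* for $f$ is a state function $U_f$ with $U_f(\ell_{out},\mathbf x)=0$ for $\mathbf x\in I(\ell_{out})$ and, for every transition $\tau=(\ell,\mathrm{Pr})$ and every $\mathbf x\in I(\ell)\cap G(\tau)$, $$U_f(\ell,\mathbf x)+f(\mathbf x^{out})\ \ge\ \sum_{\ell'\in L}\mathrm{Pr}(\ell')\,\mathbb E\big[U_f(\ell',\mathbf x')+f(\mathbf x'^{\,out})\big],$$ where $\mathbf x'$ is the random valuation obtained by performing $\tau$ at $\mathbf x$, and the random variables $U_f(\ell',\mathbf x')+f(\mathbf x'^{\,out})$ with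 $\mathrm{Pr}(\ell')>0$ are required to be integrable. An *LESM* $L_f$ is defined in the same way with $\le$ in place of $\ge$. **OST-soundness.** For a state function $\eta$, let $Y_i=\eta(\ell_i,\mathbf x_i)+f(\mathbf x_i^{out})$ along a trajectory $(\ell_0,\mathbf x_0),(\ell_1,\mathbf x_1),\dots$. The triple $(\mathcal C,\eta,f)$ is *OST-sound* if $\mathbb E_{\mathbf x}[|Y_i|]<\infty$ for all $i\ge0$ and $\mathbf x\in\theta_{in}$, and at least one of the following four conditions holds for every $\mathbf x\in\theta_{in}$ (the same condition for all $\mathbf x$): - (C1) $\mathbb P_{\mathbf x}[\mathit{TimeTerm}<c]=1$ for some constant $c$; - (C2) there is a constant $c$ with $|Y_i(\rho)|<c$ for all $i\ge 0$ and all runs $\rho$; - (C3) $\mathbb E_{\mathbf x}[\mathit{TimeTerm}]<\infty$ and there is a constant $c$ such that for all $i\ge 0$, $\mathbb E_{\mathbf x}\big[|Y_{i+1}-Y_i|\,\big|\,\mathcal F_i\big]<c$ holds $\mathbb P_{\mathbf x}$-almost surely, where $\mathcal F_i$ is generated by the first $i+1$ states; - (C4) there are real numbers $M,c_1,c_2,d$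 with $c_2>0$ such that $\mathbb P_{\mathbf x}[\mathit{TimeTerm}>n]\le c_1e^{-c_2n}$ for all sufficiently large $n\in\mathbb N$, and $|Y_{i+1}(\rho)-Y_i(\rho)|\le M(i+1)^d$ for all $i\ge0$ and all runs $\rho$. **Theorem (soundness and completeness).** Let $\mathcal C$ be an almost-surely terminating pCFG, $\Phi$ a similarity relation, $\varepsilon\ge0$, and $I$ an invariant in $\mathcal C$. Then $\mathcal C$ is **not** $\varepsilon$-DP if and only if there is an expectation super/sub-martingale witness $(\mathbf x^1,\mathbf x^2,f,U_f,L_f)$, that is: - (R1) $\mathbf x^1,\mathbf x^2\in\theta_{in}$ and $\Phi(\mathbf x^1,\mathbf x^2)$; - (R2) $f:\mathbb R^{\mathcal V_{out}}\to\mathbb R$ is non-negative and Borel-measurable; - (R3) $L_f$ is an LESM for $f$ and $(\mathcal C,L_f,f)$ is OST-sound; - (R4) $U_f$ is a UESM for $f$ and $(\mathcal C,U_f,f)$ is OST-sound; - (R5) $L_f(\ell_{in},\mathbf x^1)+f(\mathbf x^{1,out})>e^{\varepsilon}\big(U_f(\ell_{in},\mathbf x^2)+f(\mathbf x^{2,out})\big)$.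 -/

import Mathlib

open MeasureTheory ProbabilityTheory Filter

/-- The update of a transition: no update, assignment of a Borel expression to a variable, or
sampling of a variable from a fixed probability distribution on the reals. -/
inductive Update (V : Type*)
  | skip
  | assign (j : V) (u : (V → ℝ) → ℝ) (hu : Measurable u)
  | sample (j : V) (δ : ProbabilityMeasure ℝ)

namespace Update

variable {V : Type*} [DecidableEq V]

/-- Law of the valuation obtained by applying the update to the valuation `x`. -/
noncomputable def law : Update V → (V → ℝ) → Measure (V → ℝ)
  | skip, x => Measure.dirac x
  | assign j u _, x => Measure.dirac (Function.update x j (u x))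
  | sample j δ, x => (δ : Measure ℝ).map (fun r => Function.update x j r)

/-- `x'` can be obtained by applying the update to `x`. A sampled value ranges over the support
of the sampled distribution. -/
def Obtains : Update V → (V → ℝ) → (V → ℝ) → Prop
  | skip, x, x' => x' = x
  | assign j u _, x, x' => x' = Function.update x j (u x)
  | sample j δ, x, x' => ∃ r ∈ (δ : Measure ℝ).support, x' = Function.update x j r

theorem measurable_update_pair (j : V) :
    Measurable (fun p : (V → ℝ) × ℝ => Function.update p.1 j p.2) := by
  refine measurable_pi_lambda _ fun i => ?_
  by_cases h : i = j
  · subst h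
    simpa using measurable_snd
  · simp only [Function.update_of_ne h]
    exact (measurable_pi_apply i).comp measurable_fst

theorem measurable_law (u : Update V) : Measurable u.law := by
  cases u with
  | skip => exact Measure.measurable_dirac
  | assign j u hu =>
    exact Measure.measurable_dirac.comp
      ((measurable_update_pair j).comp (measurable_id.prodMk hu))
  | sample j δ =>
    refine Measure.measurable_of_measurable_coe _ fun A hA => ?_
    have h : ∀ x : V → ℝ, (law (sample j δ) x) A
        = (δ : Measure ℝ) (Prod.mk x ⁻¹' ((fun p : (V → ℝ) × ℝ => Function.update p.1 j p.2) ⁻¹' A)) := by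
      intro x
      exact Measure.map_apply ((measurable_update_pair j).comp measurable_prodMk_left) hA
    simp_rw [h]
    exact measurable_measure_prodMk_left (measurable_update_pair j hA)

instance isProbabilityMeasure_law (u : Update V) (x : V → ℝ) :
    IsProbabilityMeasure (u.law x) := by
  cases u with
  | skip => exact Measure.dirac.isProbabilityMeasure
  | assign j u hu => exact Measure.dirac.isProbabilityMeasure
  | sample j δ =>
    exact Measure.isProbabilityMeasure_map
      ((measurable_update_pair j).comp measurable_prodMk_left).aemeasurable

/-- The law of the updated valuation, as a Markov kernel. -/
noncomputable def kernel (u : Update V) : Kernel (V → ℝ) (V → ℝ) := ⟨u.law, u.measurable_law⟩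

instance (u : Update V) : IsMarkovKernel u.kernel := ⟨fun x => u.isProbabilityMeasure_law x⟩

end Update

/-- A probabilistic control-flow graph with locations `L` and real-valued program variables `V`. -/
structure PCFG (L V : Type*) where
  /-- the output variables -/
  outVars : Set V
  /-- the initial location -/
  locIn : L
  /-- the terminal location -/
  locOut : L
  /-- the initial variable valuations, i.e. the inputs -/
  inputs : Set (V → ℝ)
  /-- the transitions `(ℓ, Pr)`: a source and a distribution over successor locations -/
  transitions : Finset (L × PMF L)
  /-- the guard of a transition -/
  guard : transitions → Set (V → ℝ)
  measurableSet_guard : ∀ τ, MeasurableSet (guard τ)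
  /-- the update of a transition -/
  up : transitions → Update V
  /-- the only transition out of the terminal location is a trivial self-loop -/
  terminal : ∀ τ : transitions, τ.1.1 = locOut →
    τ.1.2 = PMF.pure locOut ∧ guard τ = Set.univ ∧ up τ = Update.skip
  /-- some transition is enabled in every state -/
  exists_enabled : ∀ (ℓ : L) (x : V → ℝ), ∃ τ : transitions, τ.1.1 = ℓ ∧ x ∈ guard τ
  /-- distinct transitions with the same source have mutually exclusive guards -/
  exclusive : ∀ τ₁ τ₂ : transitions, τ₁ ≠ τ₂ → τ₁.1.1 = τ₂.1.1 → Disjoint (guard τ₁) (guard τ₂)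

/-- States of a pCFG: a location and a variable valuation. -/
abbrev PState (L V : Type*) := L × (V → ℝ)

namespace PCFG

section Paths

variable {L V : Type*} [DecidableEq V] (C : PCFG L V)

/-- The transition `τ` is enabled at the state `s`. -/
def Enabled (τ : C.transitions) (s : PState L V) : Prop := τ.1.1 = s.1 ∧ s.2 ∈ C.guard τ

/-- `s'` is a successor of `s`. -/
def Succ (s s' : PState L V) : Prop :=
  ∃ τ : C.transitions, C.Enabled τ s ∧ τ.1.2 s'.1 ≠ 0 ∧ (C.up τ).Obtains s.2 s'.2

/-- Initial states. -/
def IsInitial (s : PState L V) : Prop := s.1 = C.locIn ∧ s.2 ∈ C.inputs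

/-- The runs of the pCFG. -/
def Run : Set (ℕ → PState L V) := {ρ | C.IsInitial (ρ 0) ∧ ∀ n, C.Succ (ρ n) (ρ (n + 1))}

/-- `s` is the last state of some finite path. -/
def Reachable (s : PState L V) : Prop := ∃ s₀, C.IsInitial s₀ ∧ Relation.ReflTransGen C.Succ s₀ s

/-- A predicate function is an invariant if it contains all reachable states. -/
def IsInvariant (I : L → Set (V → ℝ)) : Prop := ∀ s, C.Reachable s → s.2 ∈ I s.1

/-- The projection of a valuation to the output variables. -/
def out (x : V → ℝ) : C.outVars → ℝ := fun v => x v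

/-- The trajectories which reach a terminal state. -/
def Term : Set (ℕ → PState L V) := {ρ | ∃ n, (ρ n).1 = C.locOut}

/-- The number of steps before termination (`⊤` if there is no termination). -/
noncomputable def timeTerm (ρ : ℕ → PState L V) : ℕ∞ :=
  ⨅ (n : ℕ) (_ : (ρ n).1 = C.locOut), (n : ℕ∞)

/-- The trajectories which reach a terminal state whose output lies in `A`. -/
def Output (A : Set (C.outVars → ℝ)) : Set (ℕ → PState L V) :=
  {ρ | ∃ n, (ρ n).1 = C.locOut ∧ C.out (ρ n).2 ∈ A}

/-- The value of `η + f` at the `i`-th state of a trajectory. -/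
def Y (η : L → (V → ℝ) → ℝ) (f : (C.outVars → ℝ) → ℝ) (i : ℕ) (ρ : ℕ → PState L V) : ℝ :=
  η (ρ i).1 (ρ i).2 + f (C.out (ρ i).2)

end Paths

section Semantics

variable {L V : Type*} [Fintype L] [MeasurableSpace L] [DiscreteMeasurableSpace L]
  [DecidableEq V] (C : PCFG L V)

open Classical in
/-- The distribution of the next state: the enabled transition `τ = (ℓ, Pr)` chooses the
successor location from `Pr` and, independently, the successor valuation from its update. -/
noncomputable def stepLaw (s : PState L V) : Measure (PState L V) :=
  ∑ τ : C.transitions, if C.Enabled τ s then τ.1.2.toMeasure.prod ((C.up τ).law s.2) else 0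

theorem measurable_stepLaw : Measurable C.stepLaw := by
  classical
  refine Measure.measurable_of_measurable_coe _ fun A hA => ?_
  simp only [stepLaw, Measure.coe_finsetSum, Finset.sum_apply]
  refine Finset.measurable_fun_sum _ fun τ _ => ?_
  have hE : MeasurableSet {s : PState L V | C.Enabled τ s} := by
    refine MeasurableSet.inter (s₁ := {s : PState L V | τ.1.1 = s.1}) ?_
      (measurable_snd (C.measurableSet_guard τ))
    exact measurable_fst (MeasurableSet.of_discrete (s := {ℓ : L | τ.1.1 = ℓ}))
  have hK : Measurable fun s : PState L V =>
      (τ.1.2.toMeasure.prod ((C.up τ).law s.2)) A := by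
    have h : ∀ s : PState L V, (τ.1.2.toMeasure.prod ((C.up τ).law s.2)) A
        = (Kernel.const _ τ.1.2.toMeasure ×ₖ (C.up τ).kernel) s.2 A := by
      intro s
      rw [Kernel.prod_apply]
      rfl
    simp_rw [h]
    exact (Kernel.measurable_coe _ hA).comp measurable_snd
  have h : (fun s : PState L V =>
      (if C.Enabled τ s then τ.1.2.toMeasure.prod ((C.up τ).law s.2) else 0) A)
      = fun s => if C.Enabled τ s then (τ.1.2.toMeasure.prod ((C.up τ).law s.2)) A else 0 := by
    funext s
    split_ifs <;> rfl
  rw [h]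
  exact Measurable.ite hE hK measurable_const

set_option linter.unusedSectionVars false in
theorem isProbabilityMeasure_stepLaw (s : PState L V) : IsProbabilityMeasure (C.stepLaw s) := by
  classical
  obtain ⟨τ, h1, h2⟩ := C.exists_enabled s.1 s.2
  have : C.stepLaw s = τ.1.2.toMeasure.prod ((C.up τ).law s.2) := by
    unfold stepLaw
    rw [Finset.sum_eq_single τ]
    · rw [if_pos ⟨h1, h2⟩]
    · intro σ _ hσ
      refine if_neg fun h => ?_
      exact Set.disjoint_left.1 (C.exclusive σ τ hσ (h.1.trans h1.symm)) h.2 h2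
    · simp
  rw [this]
  infer_instance

/-- The transition kernel of the Markov chain of the pCFG. -/
noncomputable def stepKernel : Kernel (PState L V) (PState L V) :=
  ⟨C.stepLaw, C.measurable_stepLaw⟩

instance : IsMarkovKernel C.stepKernel := ⟨C.isProbabilityMeasure_stepLaw⟩

/-- The transition kernel, as a function of the whole history up to time `n`. -/
noncomputable def histKernel (n : ℕ) :
    Kernel (Π _ : Finset.Iic n, PState L V) (PState L V) :=
  C.stepKernel.comap (fun h => h ⟨n, Finset.mem_Iic.2 le_rfl⟩) (measurable_pi_apply _)

instance (n : ℕ) : IsMarkovKernel (C.histKernel n) := by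
  unfold histKernel; infer_instance

/-- The law of the trajectory of the Markov chain started in the initial state `(ℓ_in, x)`. It is
a measure on all sequences of states; the sequences which are not runs form a null set. -/
noncomputable def P (x : V → ℝ) : Measure (ℕ → PState L V) :=
  Kernel.traj (X := fun _ => PState L V) C.histKernel 0 (fun _ => (C.locIn, x))

/-- Almost-sure termination. -/
def ASTerminating : Prop := ∀ x ∈ C.inputs, C.P x C.Term = 1

/-- `ε`-differential privacy with respect to the similarity relation `Φ`. -/
def IsDP (Φ : (V → ℝ) → (V → ℝ) → Prop) (ε : ℝ) : Prop :=
  ∀ x₁ ∈ C.inputs, ∀ x₂ ∈ C.inputs, Φ x₁ x₂ → ∀ A : Set (C.outVars → ℝ), MeasurableSet A →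
    C.P x₁ (C.Output A) ≤ ENNReal.ofReal (Real.exp ε) * C.P x₂ (C.Output A)

/-- State functions: real functions of states which are Borel in the valuation. -/
def IsStateFunction (η : L → (V → ℝ) → ℝ) : Prop := ∀ ℓ, Measurable (η ℓ)

/-- The expectations `𝔼[η(ℓ', x') + f(x'^out)]` for the valuation `x'` obtained by performing `τ`
at `x` are well defined, for all possible successor locations `ℓ'`. -/
def StepIntegrable (η : L → (V → ℝ) → ℝ) (f : (C.outVars → ℝ) → ℝ) (τ : C.transitions)
    (x : V → ℝ) : Prop :=
  ∀ ℓ', τ.1.2 ℓ' ≠ 0 → Integrable (fun x' => η ℓ' x' + f (C.out x')) ((C.up τ).law x)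

/-- `∑ ℓ', Pr(ℓ') * 𝔼[η(ℓ', x') + f(x'^out)]` for the transition `τ = (ℓ, Pr)` performed at `x`. -/
noncomputable def stepExp (η : L → (V → ℝ) → ℝ) (f : (C.outVars → ℝ) → ℝ) (τ : C.transitions)
    (x : V → ℝ) : ℝ :=
  ∑ ℓ', (τ.1.2 ℓ').toReal * ∫ x', (η ℓ' x' + f (C.out x')) ∂((C.up τ).law x)

/-- Upper expectation supermartingales for `f` supported by `I`. -/
structure IsUESM (I : L → Set (V → ℝ)) (f : (C.outVars → ℝ) → ℝ) (U : L → (V → ℝ) → ℝ) :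
    Prop where
  stateFunction : IsStateFunction U
  zero_on_output : ∀ x ∈ I C.locOut, U C.locOut x = 0
  expected_decrease : ∀ (τ : C.transitions) (x : V → ℝ), x ∈ I τ.1.1 → x ∈ C.guard τ →
    C.StepIntegrable U f τ x ∧ C.stepExp U f τ x ≤ U τ.1.1 x + f (C.out x)

/-- Lower expectation submartingales for `f` supported by `I`. -/
structure IsLESM (I : L → Set (V → ℝ)) (f : (C.outVars → ℝ) → ℝ) (Λ : L → (V → ℝ) → ℝ) :
    Prop where
  stateFunction : IsStateFunction Λ
  zero_on_output : ∀ x ∈ I C.locOut, Λ C.locOut x = 0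
  expected_increase : ∀ (τ : C.transitions) (x : V → ℝ), x ∈ I τ.1.1 → x ∈ C.guard τ →
    C.StepIntegrable Λ f τ x ∧ Λ τ.1.1 x + f (C.out x) ≤ C.stepExp Λ f τ x

/-- (C1) Bounded termination time. -/
def BoundedTime (x : V → ℝ) : Prop := ∃ c : ℕ, C.P x {ρ | C.timeTerm ρ < c} = 1

/-- (C2) Bounded values along all runs. -/
def BoundedValues (η : L → (V → ℝ) → ℝ) (f : (C.outVars → ℝ) → ℝ) : Prop :=
  ∃ c : ℝ, ∀ i, ∀ ρ ∈ C.Run, |C.Y η f i ρ| < c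

/-- (C3) Finite expected termination time and bounded expected changes, conditioned on the
canonical filtration of the trajectory. -/
def BoundedExpectedChanges (η : L → (V → ℝ) → ℝ) (f : (C.outVars → ℝ) → ℝ) (x : V → ℝ) : Prop :=
  (∫⁻ ρ, (C.timeTerm ρ : ENNReal) ∂(C.P x) < ⊤) ∧
  ∃ c : ℝ, ∀ i, ∀ᵐ ρ ∂(C.P x),
    ((C.P x)[fun ρ => |C.Y η f (i + 1) ρ - C.Y η f i ρ|
      | Filtration.piLE (X := fun _ => PState L V) i]) ρ < c

/-- (C4) Exponentially decreasing probability of long executions and polynomially bounded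
changes. -/
def PolynomialChanges (η : L → (V → ℝ) → ℝ) (f : (C.outVars → ℝ) → ℝ) (x : V → ℝ) : Prop :=
  ∃ M c₁ c₂ d : ℝ, 0 < c₂ ∧
    (∀ᶠ n : ℕ in atTop,
      C.P x {ρ | (n : ℕ∞) < C.timeTerm ρ} ≤ ENNReal.ofReal (c₁ * Real.exp (-c₂ * n))) ∧
    ∀ i : ℕ, ∀ ρ ∈ C.Run, |C.Y η f (i + 1) ρ - C.Y η f i ρ| ≤ M * ((i : ℝ) + 1) ^ d

/-- OST-soundness of `(C, η, f)`. -/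
def OSTSound (η : L → (V → ℝ) → ℝ) (f : (C.outVars → ℝ) → ℝ) : Prop :=
  (∀ x ∈ C.inputs, ∀ i, Integrable (C.Y η f i) (C.P x)) ∧
  ((∀ x ∈ C.inputs, C.BoundedTime x) ∨
    C.BoundedValues η f ∨
    (∀ x ∈ C.inputs, C.BoundedExpectedChanges η f x) ∨
    (∀ x ∈ C.inputs, C.PolynomialChanges η f x))

/-- Expectation super/sub-martingale witnesses for the refutation of `ε`-differential privacy. -/
structure IsWitness (Φ : (V → ℝ) → (V → ℝ) → Prop) (ε : ℝ) (I : L → Set (V → ℝ))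
    (x₁ x₂ : V → ℝ) (f : (C.outVars → ℝ) → ℝ) (U Λ : L → (V → ℝ) → ℝ) : Prop where
  mem_left : x₁ ∈ C.inputs
  mem_right : x₂ ∈ C.inputs
  similar : Φ x₁ x₂
  measurable : Measurable f
  nonneg : ∀ y, 0 ≤ f y
  lesm : C.IsLESM I f Λ
  lesm_sound : C.OSTSound Λ f
  uesm : C.IsUESM I f U
  uesm_sound : C.OSTSound U f
  gap : Real.exp ε * (U C.locIn x₂ + f (C.out x₂)) < Λ C.locIn x₁ + f (C.out x₁)

end Semantics

end PCFG

/-!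
Let `Y n` be the value of `η + f` at the `n`-th state of a trajectory.

*Soundness.* The terminal location is absorbing, so almost every trajectory is a run which is
eventually constant, and `Y n` converges almost surely to `f` of the final output, because `η`
vanishes at reachable terminal states. Since the final state is never left, no stopping of the
process is needed: by the Markov property `map_P_pair` the expectation of `Y n` itself is monotone
in `n` for a super- or submartingale. Passage to the limit is by dominated convergence. Bounded
values are dominated by a constant. Under the other three conditions of OST-soundness
`∑ n, 𝔼|Y (n + 1) - Y n|` is finite, since an increment only contributes while the trajectory has
not terminated, and then `|Y 0| + ∑ n, |Y (n + 1) - Y n|` dominates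
(`tendsto_integral_of_tsum_lintegral_sub_ne_top`). Hence a UESM bounds the expectation of `f` of the
final output from above and an LESM bounds it from below (`IsUESM.integral_final_le`,
`IsLESM.le_integral_final`). Differential privacy says that the law of the final output for one
input is at most `exp ε` times that for the other, and this inequality of measures passes to
integrals of the nonnegative function `f`, contradicting the gap of a witness.

*Completeness.* If an output set `A` violates differential privacy, let `f` be its indicator and
let `h s` be the probability of terminating from the state `s` with an output in `A`. The function
`h` is the increasing limit of the probabilities of having done so within `n` steps, hence harmonic
by monotone convergence (`outputProb_eq_lintegral`), it is bounded by `1`, and it agrees with `f` at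
terminal states. So `h - f` is both a UESM and an LESM, OST-sound because its values `Y n` are
bounded, and its gap is exactly the violation of differential privacy.
-/

set_option linter.unusedSectionVars false

/-! ### Sequences with summable increments -/

/-- If the increments of a sequence have summable `L¹` norms, then its almost-sure limit is
integrable, and its integrals converge to that of the limit. -/
theorem MeasureTheory.tendsto_integral_of_tsum_lintegral_sub_ne_top {Ω : Type*}
    [MeasurableSpace Ω] {μ : Measure Ω} {X : ℕ → Ω → ℝ} {Z : Ω → ℝ}
    (hX : ∀ n, Integrable (X n) μ)
    (hs : ∑' n, ∫⁻ ω, ‖X (n + 1) ω - X n ω‖ₑ ∂μ ≠ ⊤)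
    (hZ : ∀ᵐ ω ∂μ, Tendsto (fun n => X n ω) atTop (nhds (Z ω))) :
    Integrable Z μ ∧ Tendsto (fun n => ∫ ω, X n ω ∂μ) atTop (nhds (∫ ω, Z ω ∂μ)) := by
  set S : Ω → ENNReal := fun ω => ∑' n, ‖X (n + 1) ω - X n ω‖ₑ with hS
  have hm : ∀ n, AEMeasurable (fun ω => ‖X (n + 1) ω - X n ω‖ₑ) μ := fun n =>
    ((hX (n + 1)).1.sub (hX n).1).enorm
  have hSm : AEMeasurable S μ := AEMeasurable.tsum hm
  have hSi : ∫⁻ ω, S ω ∂μ ≠ ⊤ := by rwa [hS, lintegral_tsum hm]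
  have hg : Integrable (fun ω => |X 0 ω| + (S ω).toReal) μ :=
    (hX 0).abs.add (integrable_toReal_of_lintegral_ne_top hSm hSi)
  -- The telescoping bound `|X n| ≤ |X 0| + ∑ |X (k + 1) - X k|` dominates the whole sequence.
  have hb : ∀ᵐ ω ∂μ, ∀ n, ‖X n ω‖ ≤ |X 0 ω| + (S ω).toReal := by
    filter_upwards [ae_lt_top' hSm hSi] with ω hω n
    have h1 : |X n ω| ≤ |X 0 ω| + ∑ k ∈ Finset.range n, |X (k + 1) ω - X k ω| := by
      have h2 : X n ω = X 0 ω + ∑ k ∈ Finset.range n, (X (k + 1) ω - X k ω) := by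
        rw [Finset.sum_range_sub (fun k => X k ω)]; ring
      calc |X n ω| = |X 0 ω + ∑ k ∈ Finset.range n, (X (k + 1) ω - X k ω)| := by rw [← h2]
        _ ≤ _ := (abs_add_le _ _).trans (add_le_add_right (Finset.abs_sum_le_sum_abs _ _) _)
    have h3 : ∑ k ∈ Finset.range n, |X (k + 1) ω - X k ω| ≤ (S ω).toReal := by
      have h4 : ∑ k ∈ Finset.range n, ‖X (k + 1) ω - X k ω‖ₑ ≤ S ω := ENNReal.sum_le_tsum _
      have h5 := ENNReal.toReal_mono hω.ne h4
      rw [ENNReal.toReal_sum (fun _ _ => enorm_ne_top)] at h5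
      simpa [Real.norm_eq_abs] using h5
    exact h1.trans (add_le_add_right h3 _)
  refine ⟨hg.mono' (aestronglyMeasurable_of_tendsto_ae _ (fun n => (hX n).1) hZ) ?_,
    tendsto_integral_of_dominated_convergence _ (fun n => (hX n).1) hg (ae_all_iff.1 hb) hZ⟩
  filter_upwards [hb, hZ] with ω h1 h2
  exact le_of_tendsto' h2.norm h1

theorem ENNReal.tsum_ne_top_of_tsum_add_ne_top {a : ℕ → ENNReal} (ha : ∀ n, a n ≠ ⊤) (N : ℕ)
    (h : ∑' n, a (n + N) ≠ ⊤) : ∑' n, a n ≠ ⊤ := by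
  rw [← Summable.sum_add_tsum_nat_add' (f := a) (k := N) ENNReal.summable]
  exact ENNReal.add_ne_top.2 ⟨ENNReal.sum_ne_top.2 fun n _ => ha n, h⟩

theorem summable_rpow_mul_exp_neg_nat_mul (d c : ℝ) (hc : 0 < c) :
    Summable fun n : ℕ => ((n : ℝ) + 1) ^ d * Real.exp (-c * n) := by
  have h := (summable_nat_add_iff 1).2 (Real.summable_pow_mul_exp_neg_nat_mul ⌈d⌉₊ hc)
  refine Summable.of_nonneg_of_le (fun n => by positivity) (fun n => ?_)
    (h.mul_left (Real.exp c))
  have h1 : ((n : ℝ) + 1) ^ d ≤ ((n : ℝ) + 1) ^ ⌈d⌉₊ := by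
    rw [← Real.rpow_natCast]
    exact Real.rpow_le_rpow_of_exponent_le (by linarith [(Nat.cast_nonneg n : (0 : ℝ) ≤ n)])
      (Nat.le_ceil d)
  have h2 : Real.exp (-c * n) = Real.exp c * Real.exp (-c * ((n + 1 : ℕ) : ℝ)) := by
    rw [← Real.exp_add]
    congr 1
    push_cast
    ring
  calc ((n : ℝ) + 1) ^ d * Real.exp (-c * n)
      ≤ ((n : ℝ) + 1) ^ ⌈d⌉₊ * Real.exp (-c * n) := by gcongr
    _ = _ := by rw [h2]; push_cast; ring

/-! ### Supports of distributions and updates -/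

theorem PMF.ae_ne_zero {L : Type*} [MeasurableSpace L] [DiscreteMeasurableSpace L] [Countable L]
    (p : PMF L) : ∀ᵐ ℓ ∂p.toMeasure, p ℓ ≠ 0 := by
  rw [ae_iff, PMF.toMeasure_apply_eq_zero_iff _ .of_discrete]
  simp [Set.disjoint_left, PMF.mem_support_iff]

namespace Update

variable {V : Type*} [DecidableEq V]

theorem obtains_sample_iff (j : V) (δ : ProbabilityMeasure ℝ) (x x' : V → ℝ) :
    (sample j δ).Obtains x x' ↔
      x' j ∈ (δ : Measure ℝ).support ∧ x' = Function.update x j (x' j) := by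
  constructor
  · rintro ⟨r, hr, rfl⟩
    simp [hr]
  · rintro ⟨h, h'⟩
    exact ⟨x' j, h, h'⟩

theorem measurableSet_obtains [Countable V] (u : Update V) :
    MeasurableSet {p : (V → ℝ) × (V → ℝ) | u.Obtains p.1 p.2} := by
  cases u with
  | skip => exact measurableSet_eq_fun measurable_snd measurable_fst
  | assign j u hu =>
    exact measurableSet_eq_fun measurable_snd
      ((measurable_update_pair j).comp (measurable_fst.prodMk (hu.comp measurable_fst)))
  | sample j δ =>
    simp only [obtains_sample_iff]
    have hj : Measurable fun p : (V → ℝ) × (V → ℝ) => p.2 j :=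
      (measurable_pi_apply j).comp measurable_snd
    exact (hj Measure.isClosed_support.measurableSet).inter
      (measurableSet_eq_fun measurable_snd
        ((measurable_update_pair j).comp (measurable_fst.prodMk hj)))

theorem ae_obtains [Countable V] (u : Update V) (x : V → ℝ) :
    ∀ᵐ x' ∂(u.law x), u.Obtains x x' := by
  have hm : MeasurableSet {x' | u.Obtains x x'} :=
    u.measurableSet_obtains.preimage (measurable_prodMk_left (x := x))
  cases u with
  | skip => exact (ae_dirac_iff hm).2 rfl
  | assign j u hu => exact (ae_dirac_iff hm).2 rfl
  | sample j δ =>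
    refine (ae_map_iff ((measurable_update_pair j).comp
      measurable_prodMk_left).aemeasurable hm).2 ?_
    filter_upwards [Measure.support_mem_ae (μ := (δ : Measure ℝ))] with r hr
    exact ⟨r, hr, rfl⟩

end Update

namespace PCFG

/-! ### Paths and termination -/

section Basic

variable {L V : Type*} [DecidableEq V] (C : PCFG L V)

theorem succ_of_locOut {s s' : PState L V} (h : C.Succ s s') (hs : s.1 = C.locOut) : s' = s := by
  obtain ⟨τ, ⟨h1, -⟩, h3, h4⟩ := h
  obtain ⟨hp, -, hu⟩ := C.terminal τ (h1.trans hs)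
  rw [hp] at h3
  rw [hu] at h4
  refine Prod.ext ?_ h4
  by_contra hne
  rw [hs] at hne
  exact h3 ((PMF.pure_apply_of_ne _ _ hne))

/-- The terminal location is absorbing: a path stays in the terminal state it has reached. -/
theorem eq_of_locOut {ρ : ℕ → PState L V} (hρ : ∀ n, C.Succ (ρ n) (ρ (n + 1))) {m n : ℕ}
    (hm : (ρ m).1 = C.locOut) (hmn : m ≤ n) : ρ n = ρ m := by
  induction n, hmn using Nat.le_induction with
  | base => rfl
  | succ k hk ih => rw [C.succ_of_locOut (hρ k) (by rw [ih, hm]), ih]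

theorem reachable_of_run {ρ : ℕ → PState L V} (hρ : ρ ∈ C.Run) (n : ℕ) : C.Reachable (ρ n) := by
  refine ⟨ρ 0, hρ.1, ?_⟩
  induction n with
  | zero => exact .refl
  | succ k ih => exact ih.tail (hρ.2 k)

theorem le_timeTerm_iff {ρ : ℕ → PState L V} {n : ℕ} :
    (n : ℕ∞) ≤ C.timeTerm ρ ↔ ∀ m < n, (ρ m).1 ≠ C.locOut := by
  simp only [timeTerm, le_iInf_iff, Nat.cast_le]
  exact ⟨fun h m hm he => absurd (h m he) (by omega),
    fun h m he => by by_contra hlt; exact h m (by omega) he⟩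

/-- Since the terminal location is absorbing, being outside it at time `n` means that it has not
been visited before. -/
theorem lt_timeTerm_of_ne {ρ : ℕ → PState L V} (hρ : ∀ n, C.Succ (ρ n) (ρ (n + 1))) {n : ℕ}
    (hn : (ρ n).1 ≠ C.locOut) : (n : ℕ∞) < C.timeTerm ρ := by
  have h : ((n + 1 : ℕ) : ℕ∞) ≤ C.timeTerm ρ := by
    rw [le_timeTerm_iff]
    intro m hm he
    exact hn (by rw [C.eq_of_locOut hρ he (by omega), he])
  exact lt_of_lt_of_le (by exact_mod_cast Nat.lt_succ_self n) h

end Basic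

/-! ### One step of the Markov chain -/

section Step

variable {L V : Type*} [Fintype L] [MeasurableSpace L] [DiscreteMeasurableSpace L]
  [DecidableEq V] (C : PCFG L V)

theorem stepLaw_of_enabled {τ : C.transitions} {s : PState L V} (h : C.Enabled τ s) :
    C.stepLaw s = τ.1.2.toMeasure.prod ((C.up τ).law s.2) := by
  classical
  unfold stepLaw
  rw [Finset.sum_eq_single τ, if_pos h]
  · intro σ _ hσ
    exact if_neg fun h' =>
      Set.disjoint_left.1 (C.exclusive σ τ hσ (h'.1.trans h.1.symm)) h'.2 h.2
  · simp

theorem stepKernel_apply (s : PState L V) : C.stepKernel s = C.stepLaw s := rfl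

end Step

section Successors

variable {L V : Type*} [Fintype L] [MeasurableSpace L] [DiscreteMeasurableSpace L]
  [Fintype V] [DecidableEq V] (C : PCFG L V)

/-- The successor relation is measurable, so that almost-sure statements about one step can be
transferred to trajectories. -/
theorem measurableSet_succ : MeasurableSet {p : PState L V × PState L V | C.Succ p.1 p.2} := by
  have h : {p : PState L V × PState L V | C.Succ p.1 p.2} = ⋃ τ : C.transitions,
      ({p | τ.1.1 = p.1.1} ∩ {p | p.1.2 ∈ C.guard τ}) ∩
        ({p | τ.1.2 p.2.1 ≠ 0} ∩ {p | (C.up τ).Obtains p.1.2 p.2.2}) := by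
    ext p
    simp [Succ, Enabled]
  rw [h]
  refine MeasurableSet.iUnion fun τ => ?_
  refine ((?_ : MeasurableSet _).inter ?_).inter ((?_ : MeasurableSet _).inter ?_)
  · exact (measurable_fst.comp measurable_fst)
      (MeasurableSet.of_discrete (s := {ℓ : L | τ.1.1 = ℓ}))
  · exact (measurable_snd.comp measurable_fst) (C.measurableSet_guard τ)
  · exact (measurable_fst.comp measurable_snd)
      (MeasurableSet.of_discrete (s := {ℓ : L | τ.1.2 ℓ ≠ 0}))
  · exact ((measurable_snd.comp measurable_fst).prodMk (measurable_snd.comp measurable_snd))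
      (C.up τ).measurableSet_obtains

theorem measurable_out : Measurable C.out :=
  measurable_pi_lambda _ fun v => measurable_pi_apply v.1

theorem measurable_value {η : L → (V → ℝ) → ℝ} (hη : IsStateFunction η)
    {f : (C.outVars → ℝ) → ℝ} (hf : Measurable f) :
    Measurable fun s : PState L V => η s.1 s.2 + f (C.out s.2) :=
  (measurable_from_prod_countable_right (f := fun s : PState L V => η s.1 s.2) hη).add
    (hf.comp (C.measurable_out.comp measurable_snd))

theorem ae_succ (s : PState L V) : ∀ᵐ s' ∂(C.stepLaw s), C.Succ s s' := by
  obtain ⟨τ, hτ⟩ := C.exists_enabled s.1 s.2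
  rw [C.stepLaw_of_enabled hτ]
  filter_upwards [Measure.quasiMeasurePreserving_fst.ae τ.1.2.ae_ne_zero,
    Measure.quasiMeasurePreserving_snd.ae ((C.up τ).ae_obtains s.2)] with s' h h'
  exact ⟨τ, hτ, h, h'⟩

/-- The expectation after one step which occurs in the definition of super- and submartingales is
the integral with respect to the transition kernel. -/
theorem integral_stepLaw_eq_stepExp {η : L → (V → ℝ) → ℝ} (hη : IsStateFunction η)
    {f : (C.outVars → ℝ) → ℝ} (hf : Measurable f) {τ : C.transitions} {s : PState L V}
    (h : C.Enabled τ s) (hi : C.StepIntegrable η f τ s.2) :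
    ∫ s', (η s'.1 s'.2 + f (C.out s'.2)) ∂(C.stepLaw s) = C.stepExp η f τ s.2 := by
  have hm : Integrable (fun s' : PState L V => η s'.1 s'.2 + f (C.out s'.2))
      (τ.1.2.toMeasure.prod ((C.up τ).law s.2)) := by
    refine (integrable_prod_iff (C.measurable_value hη hf).aestronglyMeasurable).2
      ⟨?_, Integrable.of_finite⟩
    filter_upwards [τ.1.2.ae_ne_zero] with ℓ hℓ
    exact hi ℓ hℓ
  rw [C.stepLaw_of_enabled h, integral_prod _ hm, PMF.integral_eq_sum]
  rfl

end Successors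

/-! ### The law of the trajectory -/

section Traj

variable {L V : Type*} [Fintype L] [MeasurableSpace L] [DiscreteMeasurableSpace L]
  [DecidableEq V] (C : PCFG L V)

instance (x : V → ℝ) : IsProbabilityMeasure (C.P x) := by unfold P; infer_instance

/-- The Markov property: conditionally on the `n`-th state, the next state is distributed
according to the transition kernel. -/
theorem map_P_pair (x : V → ℝ) (n : ℕ) :
    (C.P x).map (fun ρ => (ρ n, ρ (n + 1))) =
      ((C.P x).map (fun ρ => ρ n)) ⊗ₘ C.stepKernel := by
  have hn : Measurable fun h : (Π _ : Finset.Iic n, PState L V) =>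
      h ⟨n, Finset.mem_Iic.2 le_rfl⟩ := measurable_pi_apply _
  have h1 : (C.P x).map (Preorder.frestrictLe (π := fun _ => PState L V) n) =
      Kernel.partialTraj (X := fun _ => PState L V) C.histKernel 0 n (fun _ => (C.locIn, x)) :=
    Kernel.traj_map_frestrictLe_apply ..
  -- The trajectory law has this property for the whole history; project it to its last state.
  have h2 := Kernel.partialTraj_compProd_eq_map_traj (X := fun _ => PState L V)
    (κ := C.histKernel) (zero_le (a := n)) (x₀ := fun _ => (C.locIn, x))
  have h3 : (fun ρ : ℕ → PState L V => ρ n) =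
      (fun h : (Π _ : Finset.Iic n, PState L V) => h ⟨n, Finset.mem_Iic.2 le_rfl⟩) ∘
        Preorder.frestrictLe (π := fun _ => PState L V) n := rfl
  have h4 : (fun ρ : ℕ → PState L V => (ρ n, ρ (n + 1))) =
      (Prod.map (fun h : (Π _ : Finset.Iic n, PState L V) => h ⟨n, Finset.mem_Iic.2 le_rfl⟩) id) ∘
        fun ρ => (Preorder.frestrictLe (π := fun _ => PState L V) n ρ, ρ (n + 1)) := rfl
  rw [h3, h4, ← Measure.map_map (by fun_prop) (by fun_prop),
    ← Measure.map_map (by fun_prop) (by fun_prop), h1, P, ← h2]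
  ext S hS
  rw [Measure.map_apply (by fun_prop) hS, Measure.compProd_apply (by measurability),
    Measure.compProd_apply hS, lintegral_map (Kernel.measurable_kernel_prodMk_left hS) hn]
  rfl

theorem map_P_zero (x : V → ℝ) :
    (C.P x).map (fun ρ => ρ 0) = Measure.dirac (C.locIn, x) := by
  have h1 : (C.P x).map (Preorder.frestrictLe (π := fun _ => PState L V) 0) =
      Kernel.partialTraj (X := fun _ => PState L V) C.histKernel 0 0 (fun _ => (C.locIn, x)) :=
    Kernel.traj_map_frestrictLe_apply ..
  rw [Kernel.partialTraj_self, Kernel.id_apply] at h1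
  have h3 : (fun ρ : ℕ → PState L V => ρ 0) =
      (fun h : (Π _ : Finset.Iic 0, PState L V) => h ⟨0, Finset.mem_Iic.2 le_rfl⟩) ∘
        Preorder.frestrictLe (π := fun _ => PState L V) 0 := rfl
  rw [h3, ← Measure.map_map (by fun_prop) (by fun_prop), h1,
    Measure.map_dirac' (by fun_prop)]

theorem lintegral_P_succ (x : V → ℝ) (n : ℕ) {g : PState L V → ENNReal} (hg : Measurable g) :
    ∫⁻ ρ, g (ρ (n + 1)) ∂(C.P x) = ∫⁻ ρ, ∫⁻ s, g s ∂(C.stepKernel (ρ n)) ∂(C.P x) := by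
  calc ∫⁻ ρ, g (ρ (n + 1)) ∂(C.P x)
      = ∫⁻ p, g p.2 ∂((C.P x).map (fun ρ => (ρ n, ρ (n + 1)))) := by
        rw [lintegral_map (by fun_prop) (by fun_prop)]
    _ = _ := by
        rw [C.map_P_pair, Measure.lintegral_compProd (by fun_prop),
          lintegral_map hg.lintegral_kernel (by fun_prop)]

theorem integral_P_succ {x : V → ℝ} {n : ℕ} {g : PState L V → ℝ} (hg : Measurable g)
    (hi : Integrable (fun ρ => g (ρ (n + 1))) (C.P x)) :
    Integrable (fun ρ => ∫ s, g s ∂(C.stepKernel (ρ n))) (C.P x) ∧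
      ∫ ρ, g (ρ (n + 1)) ∂(C.P x) = ∫ ρ, ∫ s, g s ∂(C.stepKernel (ρ n)) ∂(C.P x) := by
  have hg2 : Measurable fun p : PState L V × PState L V => g p.2 := hg.comp measurable_snd
  have hn : Measurable fun ρ : ℕ → PState L V => ρ n := measurable_pi_apply n
  have hp : Measurable fun ρ : ℕ → PState L V => (ρ n, ρ (n + 1)) := by fun_prop
  have hi' : Integrable (fun p : PState L V × PState L V => g p.2)
      (((C.P x).map (fun ρ => ρ n)) ⊗ₘ C.stepKernel) := by
    rw [← C.map_P_pair]
    exact (integrable_map_measure hg2.aestronglyMeasurable hp.aemeasurable).2 hi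
  have hK : Integrable (fun s => ∫ s', g s' ∂(C.stepKernel s)) ((C.P x).map (fun ρ => ρ n)) :=
    Integrable.integral_compProd hi'
  refine ⟨(integrable_map_measure hK.1 hn.aemeasurable).1 hK, ?_⟩
  calc ∫ ρ, g (ρ (n + 1)) ∂(C.P x)
      = ∫ p, g p.2 ∂((C.P x).map (fun ρ => (ρ n, ρ (n + 1)))) := by
        rw [integral_map hp.aemeasurable hg2.aestronglyMeasurable]
    _ = _ := by
        rw [C.map_P_pair, Measure.integral_compProd hi', integral_map hn.aemeasurable hK.1]

end Traj

section Runs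

variable {L V : Type*} [Fintype L] [MeasurableSpace L] [DiscreteMeasurableSpace L]
  [Fintype V] [DecidableEq V] (C : PCFG L V)

theorem ae_zero (x : V → ℝ) : ∀ᵐ ρ ∂(C.P x), ρ 0 = (C.locIn, x) := by
  have h : ∀ᵐ s ∂((C.P x).map (fun ρ => ρ 0)), s = (C.locIn, x) := by
    rw [C.map_P_zero]
    exact (ae_dirac_iff (measurableSet_singleton _)).2 rfl
  exact ae_of_ae_map (measurable_pi_apply 0).aemeasurable h

theorem ae_succ_P (x : V → ℝ) : ∀ᵐ ρ ∂(C.P x), ∀ n, C.Succ (ρ n) (ρ (n + 1)) := by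
  refine ae_all_iff.2 fun n => ?_
  have h : ∀ᵐ p ∂((C.P x).map (fun ρ => (ρ n, ρ (n + 1)))), C.Succ p.1 p.2 := by
    rw [C.map_P_pair, Measure.ae_compProd_iff C.measurableSet_succ]
    exact ae_of_all _ C.ae_succ
  have hp : Measurable fun ρ : ℕ → PState L V => (ρ n, ρ (n + 1)) := by fun_prop
  exact ae_of_ae_map hp.aemeasurable h

theorem ae_run {x : V → ℝ} (hx : x ∈ C.inputs) : ∀ᵐ ρ ∂(C.P x), ρ ∈ C.Run := by
  filter_upwards [C.ae_zero x, C.ae_succ_P x] with ρ h0 h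
  refine ⟨?_, h⟩
  rw [h0]
  exact ⟨rfl, hx⟩

end Runs

/-! ### The final output -/

section Witness

variable {L V : Type*} [Fintype L] [MeasurableSpace L] [DiscreteMeasurableSpace L]
  [Fintype V] [DecidableEq V] (C : PCFG L V)

/-- The valuation of the output variables at termination. On the null set of trajectories which do
not terminate, it is the value at time `0`, as the infimum of the empty set of naturals is `0`. -/
noncomputable def finalOutput (ρ : ℕ → PState L V) : C.outVars → ℝ :=
  C.out (ρ (sInf {n | (ρ n).1 = C.locOut})).2

theorem measurableSet_locOut (n : ℕ) :
    MeasurableSet {ρ : ℕ → PState L V | (ρ n).1 = C.locOut} :=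
  (measurable_fst.comp (measurable_pi_apply n)) (MeasurableSet.of_discrete (s := {C.locOut}))

theorem measurableSet_term : MeasurableSet C.Term := by
  have h : C.Term = ⋃ n, {ρ | (ρ n).1 = C.locOut} := by ext; simp [Term]
  rw [h]
  exact MeasurableSet.iUnion C.measurableSet_locOut

/-- Almost every trajectory of an almost-surely terminating pCFG is a run which gets stuck in a
terminal state carrying the final output. -/
theorem ae_terminates (hC : C.ASTerminating) {x : V → ℝ} (hx : x ∈ C.inputs) :
    ∀ᵐ ρ ∂(C.P x), ρ ∈ C.Run ∧ ∃ n, (ρ n).1 = C.locOut ∧ (∀ m, n ≤ m → ρ m = ρ n) ∧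
      (∀ m, (ρ m).1 = C.locOut → ρ m = ρ n) ∧ C.finalOutput ρ = C.out (ρ n).2 := by
  have ht : ∀ᵐ ρ ∂(C.P x), ρ ∈ C.Term :=
    (mem_ae_iff_prob_eq_one C.measurableSet_term).2 (hC x hx)
  filter_upwards [C.ae_run hx, ht] with ρ hρ ht
  have hn : (ρ (sInf {n | (ρ n).1 = C.locOut})).1 = C.locOut := Nat.sInf_mem ht
  exact ⟨hρ, _, hn, fun m hm => C.eq_of_locOut hρ.2 hn hm,
    fun m hm => C.eq_of_locOut hρ.2 hn (Nat.sInf_le hm), rfl⟩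

theorem aemeasurable_finalOutput (hC : C.ASTerminating) {x : V → ℝ} (hx : x ∈ C.inputs) :
    AEMeasurable C.finalOutput (C.P x) := by
  refine aemeasurable_of_tendsto_metrizable_ae atTop (f := fun n ρ => C.out (ρ n).2)
    (fun n => ((C.measurable_out.comp measurable_snd).comp
      (measurable_pi_apply n)).aemeasurable) ?_
  filter_upwards [C.ae_terminates hC hx] with ρ ⟨_, n, _, h, _, hf⟩
  refine tendsto_const_nhds.congr' ?_
  filter_upwards [eventually_ge_atTop n] with m hm
  rw [hf, h m hm]

theorem map_finalOutput_apply (hC : C.ASTerminating) {x : V → ℝ} (hx : x ∈ C.inputs)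
    {A : Set (C.outVars → ℝ)} (hA : MeasurableSet A) :
    (C.P x).map C.finalOutput A = C.P x (C.Output A) := by
  rw [Measure.map_apply_of_aemeasurable (C.aemeasurable_finalOutput hC hx) hA]
  refine measure_congr ?_
  filter_upwards [C.ae_terminates hC hx] with ρ ⟨_, n, hn, _, h, hf⟩
  refine propext ⟨fun hA => ⟨n, hn, ?_⟩, fun ⟨m, hm, hA⟩ => ?_⟩
  · rw [← hf]; exact hA
  · change C.finalOutput ρ ∈ A
    rw [hf, ← h m hm]; exact hA

/-! ### Optional stopping -/

section Value

variable {I : L → Set (V → ℝ)} {η : L → (V → ℝ) → ℝ} {f : (C.outVars → ℝ) → ℝ}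

theorem tendsto_Y (hC : C.ASTerminating) (hI : C.IsInvariant I)
    (h0 : ∀ x ∈ I C.locOut, η C.locOut x = 0) {x : V → ℝ} (hx : x ∈ C.inputs) :
    ∀ᵐ ρ ∂(C.P x), Tendsto (fun n => C.Y η f n ρ) atTop (nhds (f (C.finalOutput ρ))) := by
  filter_upwards [C.ae_terminates hC hx] with ρ ⟨hρ, n, hn, h, _, hf⟩
  refine tendsto_const_nhds.congr' ?_
  filter_upwards [eventually_ge_atTop n] with m hm
  have hr : (ρ n).2 ∈ I C.locOut := hn ▸ hI _ (C.reachable_of_run hρ n)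
  rw [Y, h m hm, hn, h0 _ hr, zero_add, hf]

theorem measurable_Y (hη : IsStateFunction η) (hf : Measurable f) (n : ℕ) :
    Measurable (C.Y η f n) := (C.measurable_value hη hf).comp (measurable_pi_apply n)

theorem Y_succ_eq_of_locOut {ρ : ℕ → PState L V} (hρ : ρ ∈ C.Run) {n : ℕ}
    (hn : (ρ n).1 = C.locOut) : C.Y η f (n + 1) ρ = C.Y η f n ρ := by
  rw [Y, Y, C.succ_of_locOut (hρ.2 n) hn]

/-- The increments of the value vanish after termination, so only the event of not having
terminated contributes to their mean. -/
theorem lintegral_Y_sub_eq {x : V → ℝ} (hx : x ∈ C.inputs) (n : ℕ) :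
    ∫⁻ ρ, ‖C.Y η f (n + 1) ρ - C.Y η f n ρ‖ₑ ∂(C.P x) =
      ∫⁻ ρ in {ρ | (ρ n).1 = C.locOut}ᶜ, ‖C.Y η f (n + 1) ρ - C.Y η f n ρ‖ₑ ∂(C.P x) := by
  rw [← lintegral_indicator (C.measurableSet_locOut n).compl]
  refine lintegral_congr_ae ?_
  filter_upwards [C.ae_run hx] with ρ hρ
  by_cases h : (ρ n).1 = C.locOut
  · rw [C.Y_succ_eq_of_locOut hρ h]
    simp [h]
  · rw [Set.indicator_of_mem]
    exact h

theorem lintegral_enorm_Y_sub_ne_top {x : V → ℝ} (hi : ∀ n, Integrable (C.Y η f n) (C.P x))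
    (n : ℕ) : ∫⁻ ρ, ‖C.Y η f (n + 1) ρ - C.Y η f n ρ‖ₑ ∂(C.P x) ≠ ⊤ :=
  ((hi (n + 1)).sub (hi n)).2.ne

theorem measure_not_locOut_le {x : V → ℝ} (hx : x ∈ C.inputs) (n : ℕ) :
    C.P x {ρ | (ρ n).1 = C.locOut}ᶜ ≤ C.P x {ρ | (n : ℕ∞) < C.timeTerm ρ} := by
  refine measure_mono_ae ?_
  filter_upwards [C.ae_run hx] with ρ hρ h
  exact C.lt_timeTerm_of_ne hρ.2 h

/-- The tail-sum bound: on a run, the termination time counts the times spent outside the terminal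
location. -/
theorem tsum_measure_not_locOut_le {x : V → ℝ} (hx : x ∈ C.inputs) :
    ∑' n, C.P x {ρ | (ρ n).1 = C.locOut}ᶜ ≤ ∫⁻ ρ, (C.timeTerm ρ : ENNReal) ∂(C.P x) := by
  have h : ∀ n, C.P x {ρ | (ρ n).1 = C.locOut}ᶜ =
      ∫⁻ ρ, ({ρ | (ρ n).1 = C.locOut}ᶜ).indicator 1 ρ ∂(C.P x) := fun n =>
    (lintegral_indicator_one (C.measurableSet_locOut n).compl).symm
  simp_rw [h]
  rw [← lintegral_tsum fun n => (measurable_one.indicator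
    (C.measurableSet_locOut n).compl).aemeasurable]
  refine lintegral_mono_ae ?_
  filter_upwards [C.ae_run hx] with ρ hρ
  cases hT : C.timeTerm ρ with
  | top => simp
  | coe N =>
    rw [tsum_eq_sum (s := Finset.range N)]
    · calc ∑ n ∈ Finset.range N, ({ρ : ℕ → PState L V | (ρ n).1 = C.locOut}ᶜ).indicator 1 ρ
          ≤ ∑ n ∈ Finset.range N, (1 : ENNReal) :=
            Finset.sum_le_sum fun n _ => Set.indicator_le_self' (fun _ _ => zero_le) ρ
        _ = _ := by simp
    · intro n hn
      refine Set.indicator_of_notMem (fun h => hn ?_) _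
      have := C.lt_timeTerm_of_ne hρ.2 h
      rw [hT] at this
      exact Finset.mem_range.2 (by exact_mod_cast this)

/-- Under `BoundedTime`, all but finitely many increments vanish almost surely. -/
theorem tsum_ne_top_of_boundedTime {x : V → ℝ} (hx : x ∈ C.inputs)
    (hi : ∀ n, Integrable (C.Y η f n) (C.P x)) (h : C.BoundedTime x) :
    ∑' n, ∫⁻ ρ, ‖C.Y η f (n + 1) ρ - C.Y η f n ρ‖ₑ ∂(C.P x) ≠ ⊤ := by
  obtain ⟨c, hc⟩ := h
  have hs : {ρ : ℕ → PState L V | C.timeTerm ρ < c} =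
      ⋃ n ∈ Set.Iio c, {ρ | (ρ n).1 = C.locOut} := by
    ext ρ
    have := C.le_timeTerm_iff (ρ := ρ) (n := c)
    simp only [Set.mem_iUnion, Set.mem_ofPred_eq, Set.mem_Iio, ← not_le, this]
    push Not
    simp
  have hm : MeasurableSet {ρ : ℕ → PState L V | C.timeTerm ρ < c} := by
    rw [hs]
    exact MeasurableSet.biUnion (Set.to_countable _) fun n _ => C.measurableSet_locOut n
  have ha : ∀ᵐ ρ ∂(C.P x), C.timeTerm ρ < c := (mem_ae_iff_prob_eq_one hm).2 hc
  refine ENNReal.tsum_ne_top_of_tsum_add_ne_top (C.lintegral_enorm_Y_sub_ne_top hi) c ?_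
  have hz : ∀ n, ∫⁻ ρ, ‖C.Y η f (n + c + 1) ρ - C.Y η f (n + c) ρ‖ₑ ∂(C.P x) = 0 := by
    intro n
    rw [← lintegral_zero (μ := C.P x)]
    refine lintegral_congr_ae ?_
    filter_upwards [ha, C.ae_run hx] with ρ hT hρ
    have : (ρ (n + c)).1 = C.locOut := by
      by_contra hne
      have h1 := (C.lt_timeTerm_of_ne hρ.2 hne).trans hT
      have h2 : n + c < c := by exact_mod_cast h1
      omega
    simp [C.Y_succ_eq_of_locOut hρ this]
  simp [hz]

/-- Under `BoundedExpectedChanges`, the `n`-th increment has mean at most `c` times the probability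
of not having terminated at time `n`, and these probabilities sum to at most the expected
termination time. -/
theorem tsum_ne_top_of_boundedExpectedChanges {x : V → ℝ} (hx : x ∈ C.inputs)
    (hi : ∀ n, Integrable (C.Y η f n) (C.P x)) (h : C.BoundedExpectedChanges η f x) :
    ∑' n, ∫⁻ ρ, ‖C.Y η f (n + 1) ρ - C.Y η f n ρ‖ₑ ∂(C.P x) ≠ ⊤ := by
  obtain ⟨hT, c, hc⟩ := h
  have hle : ∀ n, ∫⁻ ρ, ‖C.Y η f (n + 1) ρ - C.Y η f n ρ‖ₑ ∂(C.P x) ≤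
      ENNReal.ofReal c * C.P x {ρ | (ρ n).1 = C.locOut}ᶜ := by
    intro n
    have hd : Integrable (fun ρ => |C.Y η f (n + 1) ρ - C.Y η f n ρ|) (C.P x) :=
      ((hi (n + 1)).sub (hi n)).abs
    -- Non-termination at time `n` only depends on the first `n + 1` states.
    have hF : MeasurableSet[Filtration.piLE (X := fun _ => PState L V) n]
        {ρ : ℕ → PState L V | (ρ n).1 = C.locOut}ᶜ := by
      refine ⟨{h | (h ⟨n, Set.mem_Iic.2 le_rfl⟩).1 = C.locOut}ᶜ, MeasurableSet.compl ?_, rfl⟩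
      exact (measurable_fst.comp (measurable_pi_apply _))
        (MeasurableSet.of_discrete (s := {C.locOut}))
    have h1 : ∫⁻ ρ, ‖C.Y η f (n + 1) ρ - C.Y η f n ρ‖ₑ ∂(C.P x) = ENNReal.ofReal
        (∫ ρ in {ρ | (ρ n).1 = C.locOut}ᶜ, |C.Y η f (n + 1) ρ - C.Y η f n ρ| ∂(C.P x)) := by
      rw [C.lintegral_Y_sub_eq hx, ofReal_integral_eq_lintegral_ofReal hd.integrableOn
        (ae_of_all _ fun _ => abs_nonneg _)]
      simp_rw [← Real.enorm_eq_ofReal_abs]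
    rw [h1, ← setIntegral_condExp (Filtration.le _ n) hd hF]
    have h2 : ∫ ρ in {ρ | (ρ n).1 = C.locOut}ᶜ,
        ((C.P x)[fun ρ => |C.Y η f (n + 1) ρ - C.Y η f n ρ|
          | Filtration.piLE (X := fun _ => PState L V) n]) ρ ∂(C.P x) ≤
        ∫ ρ in {ρ : ℕ → PState L V | (ρ n).1 = C.locOut}ᶜ, c ∂(C.P x) :=
      setIntegral_mono_ae integrable_condExp.integrableOn (integrable_const c).integrableOn
        ((hc n).mono fun ρ h => h.le)
    refine (ENNReal.ofReal_le_ofReal h2).trans ?_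
    rw [setIntegral_const, smul_eq_mul, mul_comm, ENNReal.ofReal_mul' measureReal_nonneg,
      ofReal_measureReal]
  refine ne_top_of_le_ne_top ?_ (ENNReal.tsum_le_tsum hle)
  rw [ENNReal.tsum_mul_left]
  exact ENNReal.mul_ne_top ENNReal.ofReal_ne_top
    ((C.tsum_measure_not_locOut_le hx).trans_lt hT).ne

/-- Under `PolynomialChanges`, the means of the increments are eventually bounded by a power of
the time multiplied by a decaying exponential. -/
theorem tsum_ne_top_of_polynomialChanges {x : V → ℝ} (hx : x ∈ C.inputs)
    (hi : ∀ n, Integrable (C.Y η f n) (C.P x)) (h : C.PolynomialChanges η f x) :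
    ∑' n, ∫⁻ ρ, ‖C.Y η f (n + 1) ρ - C.Y η f n ρ‖ₑ ∂(C.P x) ≠ ⊤ := by
  obtain ⟨M, c₁, c₂, d, hc₂, hT, hM⟩ := h
  obtain ⟨N, hN⟩ := eventually_atTop.1 hT
  refine ENNReal.tsum_ne_top_of_tsum_add_ne_top (C.lintegral_enorm_Y_sub_ne_top hi) N ?_
  have hle : ∀ n, N ≤ n → ∫⁻ ρ, ‖C.Y η f (n + 1) ρ - C.Y η f n ρ‖ₑ ∂(C.P x) ≤
      ENNReal.ofReal (|M| * |c₁| * (((n : ℝ) + 1) ^ d * Real.exp (-c₂ * n))) := by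
    intro n hn
    have h1 : ∫⁻ ρ in {ρ | (ρ n).1 = C.locOut}ᶜ, ‖C.Y η f (n + 1) ρ - C.Y η f n ρ‖ₑ ∂(C.P x) ≤
        ∫⁻ ρ in {ρ : ℕ → PState L V | (ρ n).1 = C.locOut}ᶜ,
          ENNReal.ofReal (|M| * ((n : ℝ) + 1) ^ d) ∂(C.P x) := by
      refine lintegral_mono_ae (ae_restrict_of_ae ?_)
      filter_upwards [C.ae_run hx] with ρ hρ
      rw [Real.enorm_eq_ofReal_abs]
      refine ENNReal.ofReal_le_ofReal ((hM n ρ hρ).trans ?_)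
      gcongr
      exact le_abs_self M
    rw [C.lintegral_Y_sub_eq hx]
    refine h1.trans ?_
    rw [setLIntegral_const]
    calc ENNReal.ofReal (|M| * ((n : ℝ) + 1) ^ d) * C.P x {ρ | (ρ n).1 = C.locOut}ᶜ
        ≤ ENNReal.ofReal (|M| * ((n : ℝ) + 1) ^ d) *
            ENNReal.ofReal (|c₁| * Real.exp (-c₂ * n)) := by
          gcongr
          refine (C.measure_not_locOut_le hx n).trans ((hN n hn).trans ?_)
          gcongr
          exact le_abs_self c₁
      _ = _ := by
          rw [← ENNReal.ofReal_mul (by positivity)]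
          congr 1
          ring
  refine ne_top_of_le_ne_top ?_ (ENNReal.tsum_le_tsum fun n => hle (n + N) (by omega))
  have hsum := (summable_nat_add_iff N).2
    ((summable_rpow_mul_exp_neg_nat_mul d c₂ hc₂).mul_left (|M| * |c₁|))
  exact hsum.tsum_ofReal_ne_top

/-- The optional stopping argument: each of the four conditions allows passing to the limit in the
expected values. -/
theorem OSTSound.tendsto_integral_Y (hC : C.ASTerminating) (hI : C.IsInvariant I)
    (h0 : ∀ x ∈ I C.locOut, η C.locOut x = 0) (hs : C.OSTSound η f) {x : V → ℝ}
    (hx : x ∈ C.inputs) :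
    Integrable (fun ρ => f (C.finalOutput ρ)) (C.P x) ∧
      Tendsto (fun n => ∫ ρ, C.Y η f n ρ ∂(C.P x)) atTop
        (nhds (∫ ρ, f (C.finalOutput ρ) ∂(C.P x))) := by
  have hi := hs.1 x hx
  have hlim := C.tendsto_Y (f := f) hC hI h0 hx
  rcases hs.2 with h | h | h | h
  · exact tendsto_integral_of_tsum_lintegral_sub_ne_top hi
      (C.tsum_ne_top_of_boundedTime hx hi (h x hx)) hlim
  · obtain ⟨c, hc⟩ := h
    have hb : ∀ᵐ ρ ∂(C.P x), ∀ n, ‖C.Y η f n ρ‖ ≤ c :=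
      (C.ae_run hx).mono fun ρ hρ n => (hc n ρ hρ).le
    refine ⟨(integrable_const c).mono' (aestronglyMeasurable_of_tendsto_ae _
      (fun n => (hi n).1) hlim) ?_, tendsto_integral_of_dominated_convergence _
      (fun n => (hi n).1) (integrable_const c) (ae_all_iff.1 hb) hlim⟩
    filter_upwards [hb, hlim] with ρ h1 h2
    exact le_of_tendsto' h2.norm h1
  · exact tendsto_integral_of_tsum_lintegral_sub_ne_top hi
      (C.tsum_ne_top_of_boundedExpectedChanges hx hi (h x hx)) hlim
  · exact tendsto_integral_of_tsum_lintegral_sub_ne_top hi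
      (C.tsum_ne_top_of_polynomialChanges hx hi (h x hx)) hlim

theorem integral_Y_zero (x : V → ℝ) :
    ∫ ρ, C.Y η f 0 ρ ∂(C.P x) = η C.locIn x + f (C.out x) := by
  calc ∫ ρ, C.Y η f 0 ρ ∂(C.P x) = ∫ _, (η C.locIn x + f (C.out x)) ∂(C.P x) := by
        refine integral_congr_ae ?_
        filter_upwards [C.ae_zero x] with ρ h
        rw [Y, h]
    _ = _ := by simp

theorem IsUESM.integral_final_le (hC : C.ASTerminating) (hI : C.IsInvariant I)
    (hf : Measurable f) (hU : C.IsUESM I f η) (hs : C.OSTSound η f) {x : V → ℝ}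
    (hx : x ∈ C.inputs) :
    ∫ ρ, f (C.finalOutput ρ) ∂(C.P x) ≤ η C.locIn x + f (C.out x) := by
  rw [← C.integral_Y_zero]
  have hanti : Antitone fun n => ∫ ρ, C.Y η f n ρ ∂(C.P x) := by
    refine antitone_nat_of_succ_le fun n => ?_
    obtain ⟨h1, h2⟩ := C.integral_P_succ (C.measurable_value hU.stateFunction hf)
      (hs.1 x hx (n + 1))
    refine h2.trans_le (integral_mono_ae h1 (hs.1 x hx n) ?_)
    filter_upwards [C.ae_run hx] with ρ hρ
    obtain ⟨τ, hτ⟩ := C.exists_enabled (ρ n).1 (ρ n).2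
    have hin := hI _ (C.reachable_of_run hρ n)
    rw [← hτ.1] at hin
    obtain ⟨h3, h4⟩ := hU.expected_decrease τ _ hin hτ.2
    rw [stepKernel_apply, C.integral_stepLaw_eq_stepExp hU.stateFunction hf hτ h3]
    rwa [hτ.1] at h4
  exact hanti.le_of_tendsto (hs.tendsto_integral_Y C hC hI hU.zero_on_output hx).2 0

theorem IsLESM.le_integral_final (hC : C.ASTerminating) (hI : C.IsInvariant I)
    (hf : Measurable f) (hL : C.IsLESM I f η) (hs : C.OSTSound η f) {x : V → ℝ}
    (hx : x ∈ C.inputs) :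
    η C.locIn x + f (C.out x) ≤ ∫ ρ, f (C.finalOutput ρ) ∂(C.P x) := by
  rw [← C.integral_Y_zero]
  have hmono : Monotone fun n => ∫ ρ, C.Y η f n ρ ∂(C.P x) := by
    refine monotone_nat_of_le_succ fun n => ?_
    obtain ⟨h1, h2⟩ := C.integral_P_succ (C.measurable_value hL.stateFunction hf)
      (hs.1 x hx (n + 1))
    refine (integral_mono_ae (hs.1 x hx n) h1 ?_).trans_eq h2.symm
    filter_upwards [C.ae_run hx] with ρ hρ
    obtain ⟨τ, hτ⟩ := C.exists_enabled (ρ n).1 (ρ n).2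
    have hin := hI _ (C.reachable_of_run hρ n)
    rw [← hτ.1] at hin
    obtain ⟨h3, h4⟩ := hL.expected_increase τ _ hin hτ.2
    rw [stepKernel_apply, C.integral_stepLaw_eq_stepExp hL.stateFunction hf hτ h3]
    rwa [hτ.1] at h4
  exact hmono.ge_of_tendsto (hs.tendsto_integral_Y C hC hI hL.zero_on_output hx).2 0

end Value

/-- Soundness: differential privacy bounds the law of the output for one input by a multiple of
that for the other, hence also the expectations of `f`. -/
theorem IsWitness.not_isDP (hC : C.ASTerminating) {Φ : (V → ℝ) → (V → ℝ) → Prop} {ε : ℝ}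
    {I : L → Set (V → ℝ)} (hI : C.IsInvariant I) {x₁ x₂ : V → ℝ} {f : (C.outVars → ℝ) → ℝ}
    {U Λ : L → (V → ℝ) → ℝ} (h : C.IsWitness Φ ε I x₁ x₂ f U Λ) : ¬ C.IsDP Φ ε := by
  intro hDP
  have hle : (C.P x₁).map C.finalOutput ≤
      ENNReal.ofReal (Real.exp ε) • (C.P x₂).map C.finalOutput := by
    refine Measure.le_iff.2 fun A hA => ?_
    rw [Measure.smul_apply, smul_eq_mul, C.map_finalOutput_apply hC h.mem_left hA,
      C.map_finalOutput_apply hC h.mem_right hA]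
    exact hDP x₁ h.mem_left x₂ h.mem_right h.similar A hA
  have m₁ := C.aemeasurable_finalOutput hC h.mem_left
  have m₂ := C.aemeasurable_finalOutput hC h.mem_right
  have hi : Integrable f ((C.P x₂).map C.finalOutput) :=
    (integrable_map_measure h.measurable.aestronglyMeasurable m₂).2
      (h.uesm_sound.tendsto_integral_Y C hC hI h.uesm.zero_on_output h.mem_right).1
  have key : ∫ y, f y ∂((C.P x₁).map C.finalOutput) ≤
      Real.exp ε * ∫ y, f y ∂((C.P x₂).map C.finalOutput) := by
    have h1 := integral_mono_measure hle (ae_of_all _ h.nonneg)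
      (hi.smul_measure ENNReal.ofReal_ne_top)
    rwa [integral_smul_measure, ENNReal.toReal_ofReal (Real.exp_pos ε).le, smul_eq_mul] at h1
  rw [integral_map m₁ h.measurable.aestronglyMeasurable,
    integral_map m₂ h.measurable.aestronglyMeasurable] at key
  have hΛ := h.lesm.le_integral_final C hC hI h.measurable h.lesm_sound h.mem_left
  have hU := h.uesm.integral_final_le C hC hI h.measurable h.uesm_sound h.mem_right
  have := mul_le_mul_of_nonneg_left hU (Real.exp_pos ε).le
  linarith [h.gap]

/-! ### The probability of an output set -/

/-- The terminal states whose output lies in `A`. -/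
def outputStates (A : Set (C.outVars → ℝ)) : Set (PState L V) :=
  {s | s.1 = C.locOut ∧ C.out s.2 ∈ A}

theorem measurableSet_outputStates {A : Set (C.outVars → ℝ)} (hA : MeasurableSet A) :
    MeasurableSet (C.outputStates A) :=
  (measurable_fst (MeasurableSet.of_discrete (s := {C.locOut}))).inter
    ((C.measurable_out.comp measurable_snd) hA)

/-- The probability, as a function of the current state, that the state after `n` steps is a
terminal state whose output lies in `A`. -/
noncomputable def outputProbWithin (A : Set (C.outVars → ℝ)) : ℕ → PState L V → ENNReal
  | 0 => (C.outputStates A).indicator 1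
  | n + 1 => fun s => ∫⁻ s', outputProbWithin A n s' ∂(C.stepKernel s)

/-- The probability, as a function of the current state, of eventually terminating with an output
in `A`. -/
noncomputable def outputProb (A : Set (C.outVars → ℝ)) (s : PState L V) : ENNReal :=
  ⨆ n, C.outputProbWithin A n s

variable {A : Set (C.outVars → ℝ)}

theorem measurable_outputProbWithin (hA : MeasurableSet A) (n : ℕ) :
    Measurable (C.outputProbWithin A n) := by
  induction n with
  | zero => exact measurable_one.indicator (C.measurableSet_outputStates hA)
  | succ n ih => exact ih.lintegral_kernel

theorem measurable_outputProb (hA : MeasurableSet A) : Measurable (C.outputProb A) :=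
  Measurable.iSup (C.measurable_outputProbWithin hA)

theorem outputProbWithin_le_one (n : ℕ) (s : PState L V) : C.outputProbWithin A n s ≤ 1 := by
  induction n generalizing s with
  | zero => exact Set.indicator_le_self' (fun _ _ => zero_le) s
  | succ n ih => exact (lintegral_mono ih).trans (by simp)

theorem outputProb_le_one (s : PState L V) : C.outputProb A s ≤ 1 :=
  iSup_le fun n => C.outputProbWithin_le_one n s

theorem ae_eq_of_locOut {s : PState L V} (hs : s.1 = C.locOut) :
    ∀ᵐ s' ∂(C.stepKernel s), s' = s := by
  filter_upwards [C.ae_succ s] with s' h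
  exact C.succ_of_locOut h hs

theorem outputProbWithin_of_locOut {s : PState L V} (hs : s.1 = C.locOut) (n : ℕ) :
    C.outputProbWithin A n s = (C.outputStates A).indicator 1 s := by
  induction n with
  | zero => rfl
  | succ n ih =>
    calc ∫⁻ s', C.outputProbWithin A n s' ∂(C.stepKernel s)
        = ∫⁻ _, C.outputProbWithin A n s ∂(C.stepKernel s) :=
          lintegral_congr_ae ((C.ae_eq_of_locOut hs).mono fun s' h => by
            change C.outputProbWithin A n s' = C.outputProbWithin A n s; rw [h])
      _ = _ := by simp [ih]

theorem outputProb_of_locOut {s : PState L V} (hs : s.1 = C.locOut) :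
    C.outputProb A s = (C.outputStates A).indicator 1 s := by
  simp [outputProb, C.outputProbWithin_of_locOut hs]

theorem monotone_outputProbWithin : Monotone (C.outputProbWithin A) := by
  refine monotone_nat_of_le_succ fun n => ?_
  induction n with
  | zero =>
    intro s
    by_cases hs : s.1 = C.locOut
    · rw [C.outputProbWithin_of_locOut hs, C.outputProbWithin_of_locOut hs]
    · have : s ∉ C.outputStates A := fun h => hs h.1
      simp [outputProbWithin, this]
  | succ n ih => exact fun s => lintegral_mono ih

/-- By monotone convergence, the probability of an output in `A` is harmonic. -/
theorem outputProb_eq_lintegral (hA : MeasurableSet A) (s : PState L V) :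
    ∫⁻ s', C.outputProb A s' ∂(C.stepKernel s) = C.outputProb A s := by
  unfold outputProb
  rw [lintegral_iSup (C.measurable_outputProbWithin hA) C.monotone_outputProbWithin]
  change ⨆ n, C.outputProbWithin A (n + 1) s = _
  exact Monotone.iSup_nat_add (f := fun n => C.outputProbWithin A n s)
    (fun m n h => C.monotone_outputProbWithin h s) 1

theorem P_preimage_outputStates (hA : MeasurableSet A) (x : V → ℝ) (n : ℕ) :
    C.P x {ρ | ρ n ∈ C.outputStates A} = C.outputProbWithin A n (C.locIn, x) := by
  -- `m` steps of the trajectory followed by `k` steps of the kernel are `m + k` steps.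
  have h : ∀ m k, ∫⁻ ρ, C.outputProbWithin A k (ρ m) ∂(C.P x) =
      C.outputProbWithin A (m + k) (C.locIn, x) := by
    intro m
    induction m with
    | zero =>
      intro k
      calc ∫⁻ ρ, C.outputProbWithin A k (ρ 0) ∂(C.P x)
          = ∫⁻ _, C.outputProbWithin A k (C.locIn, x) ∂(C.P x) :=
            lintegral_congr_ae ((C.ae_zero x).mono fun ρ h => by
              change C.outputProbWithin A k (ρ 0) = _; rw [h])
        _ = _ := by simp
    | succ m ih =>
      intro k
      rw [C.lintegral_P_succ x m (C.measurable_outputProbWithin hA k)]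
      have := ih (k + 1)
      rw [show m + 1 + k = m + (k + 1) by omega, ← this]
      rfl
  have hm : MeasurableSet {ρ : ℕ → PState L V | ρ n ∈ C.outputStates A} :=
    (measurable_pi_apply n) (C.measurableSet_outputStates hA)
  rw [← lintegral_indicator_one hm]
  exact h n 0

theorem P_Output_eq_outputProb (hA : MeasurableSet A) (x : V → ℝ) :
    C.P x (C.Output A) = C.outputProb A (C.locIn, x) := by
  have hm : ∀ n, MeasurableSet {ρ : ℕ → PState L V | ρ n ∈ C.outputStates A} := fun n =>
    (measurable_pi_apply n) (C.measurableSet_outputStates hA)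
  have hO : C.Output A = ⋃ n, {ρ | ρ n ∈ C.outputStates A} := by
    ext ρ
    simp [Output, outputStates]
  have hmono : ∀ᵐ ρ ∂(C.P x), Monotone fun n =>
      ({ρ : ℕ → PState L V | ρ n ∈ C.outputStates A}).indicator
        (1 : (ℕ → PState L V) → ENNReal) ρ := by
    filter_upwards [C.ae_succ_P x] with ρ hρ
    refine monotone_nat_of_le_succ fun n => ?_
    by_cases h : ρ n ∈ C.outputStates A
    · have h' : ρ (n + 1) ∈ C.outputStates A := by
        rw [C.succ_of_locOut (hρ n) h.1]; exact h
      simp [Set.indicator, h, h']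
    · simp [Set.indicator, h]
  rw [outputProb, hO, ← lintegral_indicator_one (MeasurableSet.iUnion hm)]
  simp_rw [← C.P_preimage_outputStates hA, ← lintegral_indicator_one (hm _)]
  rw [← lintegral_iSup' (fun n => (measurable_one.indicator (hm n)).aemeasurable) hmono]
  refine lintegral_congr fun ρ => ?_
  by_cases h : ∃ n, ρ n ∈ C.outputStates A
  · obtain ⟨n, hn⟩ := h
    rw [Set.indicator_of_mem (Set.mem_iUnion.2 ⟨n, hn⟩)]
    refine le_antisymm (le_iSup_of_le n ?_) (iSup_le fun m =>
      Set.indicator_le_self' (fun _ _ => zero_le) ρ)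
    rw [Set.indicator_of_mem (by exact hn)]
  · push Not at h
    simp [Set.indicator, h]

/-- The state function whose sum with the indicator of `A` is the probability of an output
in `A`. -/
noncomputable def outputMartingale (A : Set (C.outVars → ℝ)) (ℓ : L) (x : V → ℝ) : ℝ :=
  (C.outputProb A (ℓ, x)).toReal - A.indicator 1 (C.out x)

theorem outputMartingale_add (ℓ : L) (x : V → ℝ) :
    C.outputMartingale A ℓ x + A.indicator 1 (C.out x) = (C.outputProb A (ℓ, x)).toReal :=
  sub_add_cancel _ _

theorem isStateFunction_outputMartingale (hA : MeasurableSet A) :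
    IsStateFunction (C.outputMartingale A) := fun _ =>
  ((C.measurable_outputProb hA).comp measurable_prodMk_left).ennreal_toReal.sub
    ((measurable_one.indicator hA).comp C.measurable_out)

theorem outputMartingale_locOut (x : V → ℝ) : C.outputMartingale A C.locOut x = 0 := by
  rw [outputMartingale, C.outputProb_of_locOut rfl]
  by_cases h : C.out x ∈ A <;> simp [Set.indicator, outputStates, h]

theorem outputProb_ne_top (s : PState L V) : C.outputProb A s ≠ ⊤ :=
  ne_top_of_le_ne_top ENNReal.one_ne_top (C.outputProb_le_one s)

theorem stepIntegrable_outputMartingale (hA : MeasurableSet A) (τ : C.transitions) (x : V → ℝ) :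
    C.StepIntegrable (C.outputMartingale A) (A.indicator 1) τ x := by
  intro ℓ _
  simp_rw [C.outputMartingale_add]
  refine Integrable.of_bound (C := 1)
    ((C.measurable_outputProb hA).comp measurable_prodMk_left).ennreal_toReal.aestronglyMeasurable
    (ae_of_all _ fun x' => ?_)
  rw [Real.norm_of_nonneg ENNReal.toReal_nonneg]
  exact ENNReal.toReal_le_of_le_ofReal zero_le_one (by simpa using C.outputProb_le_one _)

theorem stepExp_outputMartingale (hA : MeasurableSet A) {τ : C.transitions} {x : V → ℝ}
    (hx : x ∈ C.guard τ) :
    C.stepExp (C.outputMartingale A) (A.indicator 1) τ x =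
      C.outputMartingale A τ.1.1 x + A.indicator 1 (C.out x) := by
  have hτ : C.Enabled τ (τ.1.1, x) := ⟨rfl, hx⟩
  have h := C.integral_stepLaw_eq_stepExp (C.isStateFunction_outputMartingale hA)
    (measurable_one.indicator hA) hτ (C.stepIntegrable_outputMartingale hA τ x)
  rw [← h]
  simp_rw [C.outputMartingale_add]
  rw [← stepKernel_apply, integral_toReal (C.measurable_outputProb hA).aemeasurable
    (ae_of_all _ fun s => (C.outputProb_ne_top s).lt_top), C.outputProb_eq_lintegral hA]

theorem ostSound_outputMartingale (hA : MeasurableSet A) :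
    C.OSTSound (C.outputMartingale A) (A.indicator 1) := by
  have hb : ∀ i ρ, |C.Y (C.outputMartingale A) (A.indicator 1) i ρ| ≤ 1 := by
    intro i ρ
    rw [Y, C.outputMartingale_add, abs_of_nonneg ENNReal.toReal_nonneg]
    exact ENNReal.toReal_le_of_le_ofReal zero_le_one (by simpa using C.outputProb_le_one _)
  refine ⟨fun x _ i => Integrable.of_bound (C := 1) ?_ (ae_of_all _ (hb i)),
    Or.inr (Or.inl ⟨2, fun i ρ _ => (hb i ρ).trans_lt one_lt_two⟩)⟩
  exact (C.measurable_Y (C.isStateFunction_outputMartingale hA)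
    (measurable_one.indicator hA) i).aestronglyMeasurable

theorem isUESM_outputMartingale (I : L → Set (V → ℝ)) (hA : MeasurableSet A) :
    C.IsUESM I (A.indicator 1) (C.outputMartingale A) where
  stateFunction := C.isStateFunction_outputMartingale hA
  zero_on_output x _ := C.outputMartingale_locOut x
  expected_decrease τ x _ hx :=
    ⟨C.stepIntegrable_outputMartingale hA τ x, (C.stepExp_outputMartingale hA hx).le⟩

theorem isLESM_outputMartingale (I : L → Set (V → ℝ)) (hA : MeasurableSet A) :
    C.IsLESM I (A.indicator 1) (C.outputMartingale A) where
  stateFunction := C.isStateFunction_outputMartingale hA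
  zero_on_output x _ := C.outputMartingale_locOut x
  expected_increase τ x _ hx :=
    ⟨C.stepIntegrable_outputMartingale hA τ x, (C.stepExp_outputMartingale hA hx).ge⟩

/-- Completeness: the indicator of an output set which violates differential privacy yields a
witness. -/
theorem exists_isWitness_of_not_isDP {Φ : (V → ℝ) → (V → ℝ) → Prop} {ε : ℝ}
    (I : L → Set (V → ℝ)) (h : ¬ C.IsDP Φ ε) :
    ∃ (x₁ x₂ : V → ℝ) (f : (C.outVars → ℝ) → ℝ) (U Λ : L → (V → ℝ) → ℝ),
      C.IsWitness Φ ε I x₁ x₂ f U Λ := by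
  unfold IsDP at h
  push Not at h
  obtain ⟨x₁, hx₁, x₂, hx₂, hΦ, A, hA, hlt⟩ := h
  refine ⟨x₁, x₂, A.indicator 1, C.outputMartingale A, C.outputMartingale A, hx₁, hx₂, hΦ,
    measurable_one.indicator hA, Set.indicator_nonneg fun _ _ => zero_le_one,
    C.isLESM_outputMartingale I hA, C.ostSound_outputMartingale hA,
    C.isUESM_outputMartingale I hA, C.ostSound_outputMartingale hA, ?_⟩
  rw [C.P_Output_eq_outputProb hA, C.P_Output_eq_outputProb hA] at hlt
  rw [C.outputMartingale_add, C.outputMartingale_add]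
  have := ENNReal.toReal_strict_mono (C.outputProb_ne_top _) hlt
  rwa [ENNReal.toReal_mul, ENNReal.toReal_ofReal (Real.exp_pos ε).le] at this

end Witness

end PCFG

theorem mainTheorem1 {L V : Type*} [Fintype L] [MeasurableSpace L] [DiscreteMeasurableSpace L]
    [Fintype V] [DecidableEq V] (C : PCFG L V) (hC : C.ASTerminating)
    (Φ : (V → ℝ) → (V → ℝ) → Prop) (ε : ℝ) (hε : 0 ≤ ε)
    (I : L → Set (V → ℝ)) (hI : C.IsInvariant I) :
    ¬ C.IsDP Φ ε ↔
      ∃ (x₁ x₂ : V → ℝ) (f : (C.outVars → ℝ) → ℝ) (U Λ : L → (V → ℝ) → ℝ),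
        C.IsWitness Φ ε I x₁ x₂ f U Λ := by
  exact ⟨C.exists_isWitness_of_not_isDP I, fun ⟨_, _, _, _, _, h⟩ => h.not_isDP C hC hI⟩
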